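/- Let $\mathcal H_A,\mathcal H_B$ be finite-dimensional complex Hilbert spaces and $\mathcal H_{AB}=\mathcal H_A\otimes\mathcal H_B$. For a finite-dimensional Hilbert space $\mathcal H$ write $\mathcal P(\mathcal H)$ for the positive semidefinite operators, $\mathcal S(\mathcal H)=\{\rho\in\mathcal P(\mathcal H):\operatorname{Tr}\rho=1\}$ and $\mathcal S_\le(\mathcal H)=\{\rho\in\mathcal P(\mathcal H):0<\operatorname{Tr}\rho\le 1\}$. For $\rho,\tilde\rho\in\mathcal S_\le(\mathcal H)$ let $F(\tilde\rho,\rho)=\operatorname{Tr}|\sqrt{\tilde\rho}\sqrt{\rho}|+\sqrt{(1-\operatorname{Tr}\tilde\rho)(1-\operatorname{Tr}\rho)}$, where $|X|=\sqrt{X^\dagger X}$, let $P(\tilde\rho,\rho)=\sqrt{1-F(\tilde\rho,\rho)^2}$, and for $\delta\ge 0$ let $\mathcal B_\delta(\rho)=\{\tilde\rho\in\mathcal S_\le(\mathcal H):P(\tilde\rho,\rho)\le\delta\}$. For $\rho\in\mathcal S_\le(\mathcal H)$, $\sigma\in\mathcal P(\mathcal H)$, $\epsilon>0$ and $\delta\ge0$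 define, with values in $[-\infty,\infty]$ (with $\log_2 0=-\infty$, $\log_2\infty=\infty$ and $\inf\emptyset=\infty$), $$D_H^\epsilon(\rho\|\sigma)=-\log_2\Big(\tfrac1\epsilon\inf\{\operatorname{Tr}(Q\sigma):0\le Q\le \mathbb I,\ \operatorname{Tr}(Q\rho)\ge\epsilon\}\Big),$$ $$D_{\max}(\rho\|\sigma)=\inf\{\lambda\in\mathbb R:\rho\le 2^\lambda\sigma\},\qquad D_{\max}^{\delta}(\rho\|\sigma)=\inf_{\tilde\rho\in\mathcal B_\delta(\rho)}D_{\max}(\tilde\rho\|\sigma).$$ For $\rho\in\mathcal S(\mathcal H_{AB})$ with marginal $\rho_B=\operatorname{Tr}_A\rho$ define $$H_H^\epsilon(A|B)_\rho=-D_H^\epsilon(\rho\|\mathbb I_A\otimes\rho_B),\qquad H_{\min}(A|B)_{\rho|\rho}=-D_{\max}(\rho\|\mathbb I_A\otimes\rho_B),$$ $$H_{\min}^{\delta}(A|B)_\rho=\sup_{\tilde\rho\in\mathcal B_\delta(\rho)}\ \sup_{\sigma_B\in\mathcal S_\le(\mathcal H_B)}-D_{\max}(\tilde\rho\|\mathbb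 I_A\otimes\sigma_B).$$ Let $\rho\in\mathcal S(\mathcal H_{AB})$ and $0<\epsilon\le1$. Then for every $\sigma\in\mathcal P(\mathcal H_{AB})$ $$D_{\max}^{\sqrt{2\epsilon}}(\rho\|\sigma)\le D_H^\epsilon(\rho\|\sigma)\le D_{\max}(\rho\|\sigma),$$ and moreover $$H_{\min}^{\sqrt{2\epsilon}}(A|B)_\rho\ \ge\ H_H^\epsilon(A|B)_\rho\ \ge\ H_{\min}(A|B)_{\rho|\rho}.$$ -/

import Mathlib

open scoped MatrixOrder ComplexOrder Kronecker ENNReal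

namespace QuantumEntropy

/-! Operators on a finite-dimensional Hilbert space are complex matrices indexed by an orthonormal
basis. The composite system `AB` has the index type `a × b`. The order `X ≤ Y` of matrices says
that `Y - X` is positive semidefinite. Relative entropies are extended real numbers. -/

/-- Normalized states: positive semidefinite operators of trace one. -/
def IsState {n : Type*} [Fintype n] (ρ : Matrix n n ℂ) : Prop :=
  ρ.PosSemidef ∧ ρ.trace = 1

/-- Subnormalized states: positive semidefinite operators with `0 < Tr ρ ≤ 1`. -/
def IsSubstate {n : Type*} [Fintype n] (ρ : Matrix n n ℂ) : Prop :=
  ρ.PosSemidef ∧ 0 < ρ.trace.re ∧ ρ.trace.re ≤ 1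

/-- The trace norm `‖X‖₁ = Tr √(X† X)`. -/
noncomputable def traceNorm {n : Type*} [Fintype n] [DecidableEq n] (X : Matrix n n ℂ) : ℝ :=
  (CFC.sqrt (X.conjTranspose * X)).trace.re

/-- The generalized fidelity `‖√ρ √σ‖₁ + √((1 - Tr ρ) (1 - Tr σ))`. -/
noncomputable def genFidelity {n : Type*} [Fintype n] [DecidableEq n]
    (ρ σ : Matrix n n ℂ) : ℝ :=
  traceNorm (CFC.sqrt ρ * CFC.sqrt σ) + Real.sqrt ((1 - ρ.trace.re) * (1 - σ.trace.re))

/-- The purified distance `P(ρ, σ) = √(1 - F(ρ, σ)²)`. -/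
noncomputable def purifiedDist {n : Type*} [Fintype n] [DecidableEq n]
    (ρ σ : Matrix n n ℂ) : ℝ :=
  Real.sqrt (1 - genFidelity ρ σ ^ 2)

/-- The ball of subnormalized states at purified distance at most `ε` from `ρ`. -/
def purifiedBall {n : Type*} [Fintype n] [DecidableEq n] (ε : ℝ) (ρ : Matrix n n ℂ) :
    Set (Matrix n n ℂ) :=
  {ρ' | IsSubstate ρ' ∧ purifiedDist ρ' ρ ≤ ε}

/-- The base-two logarithm, with `log₂ 0 = -∞` and `log₂ ∞ = ∞`. -/
noncomputable def log2 (x : ℝ≥0∞) : EReal :=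
  ENNReal.log x / ((Real.log 2 : ℝ) : EReal)

/-- The tests of the hypothesis testing problem: `0 ≤ Q ≤ 1` with `Tr (Q ρ) ≥ ε`. -/
def tests {n : Type*} [Fintype n] [DecidableEq n] (ε : ℝ) (ρ : Matrix n n ℂ) :
    Set (Matrix n n ℂ) :=
  {Q | 0 ≤ Q ∧ Q ≤ 1 ∧ ε ≤ (Q * ρ).trace.re}

/-- The hypothesis-testing relative entropy,
`2 ^ (-D_H^ε(ρ‖σ)) = (1 / ε) min {Tr (Q σ) | 0 ≤ Q ≤ 1, Tr (Q ρ) ≥ ε}`. -/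
noncomputable def dH {n : Type*} [Fintype n] [DecidableEq n] (ε : ℝ)
    (ρ σ : Matrix n n ℂ) : EReal :=
  -log2 ((⨅ Q ∈ tests ε ρ, ENNReal.ofReal (Q * σ).trace.re) / ENNReal.ofReal ε)

/-- The relative max-entropy, the least real `l` with `ρ ≤ 2 ^ l σ`; it is `⊤` if there is no
such `l`. -/
noncomputable def dMax {n : Type*} [Fintype n] (ρ σ : Matrix n n ℂ) : EReal :=
  ⨅ (l : ℝ) (_ : ρ ≤ ((2 : ℝ) ^ l) • σ), (l : EReal)

/-- The smooth relative max-entropy. -/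
noncomputable def dMaxSmooth {n : Type*} [Fintype n] [DecidableEq n] (ε : ℝ)
    (ρ σ : Matrix n n ℂ) : EReal :=
  ⨅ ρ' ∈ purifiedBall ε ρ, dMax ρ' σ

/-- The marginal `ρ_B = Tr_A ρ_AB`. -/
def marginalB {a b : Type*} [Fintype a] (ρ : Matrix (a × b) (a × b) ℂ) : Matrix b b ℂ :=
  Matrix.of fun i j => ∑ k, ρ (k, i) (k, j)

/-- The conditional entropy `H_H^ε(A|B)_ρ = -D_H^ε(ρ_AB ‖ 1_A ⊗ ρ_B)`. -/
noncomputable def hH {a b : Type*} [Fintype a] [DecidableEq a] [Fintype b] [DecidableEq b]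
    (ε : ℝ) (ρ : Matrix (a × b) (a × b) ℂ) : EReal :=
  -dH ε ρ ((1 : Matrix a a ℂ) ⊗ₖ marginalB ρ)

/-- The (non-smooth) conditional min-entropy
`H_min(A|B)_{ρ|σ} = -D_max(ρ_AB ‖ 1_A ⊗ σ_B)` relative to an operator `σ_B`. -/
noncomputable def hMinRel {a b : Type*} [Fintype a] [DecidableEq a] [Fintype b]
    (ρ : Matrix (a × b) (a × b) ℂ) (σ : Matrix b b ℂ) : EReal :=
  -dMax ρ ((1 : Matrix a a ℂ) ⊗ₖ σ)

/-- The smooth conditional min-entropy `H_min^ε(A|B)_ρ`, optimized over the states `ρ'` in the ball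
around `ρ` and the subnormalized states `σ` of `B`. -/
noncomputable def hMin {a b : Type*} [Fintype a] [DecidableEq a] [Fintype b] [DecidableEq b]
    (ε : ℝ) (ρ : Matrix (a × b) (a × b) ℂ) : EReal :=
  ⨆ ρ' ∈ purifiedBall ε ρ, ⨆ (σ : Matrix b b ℂ) (_ : IsSubstate σ), hMinRel ρ' σ

end QuantumEntropy

open QuantumEntropy

/-! The bound by `dMax` is weak duality: `ρ ≤ 2^l σ` gives `ε ≤ Tr (Q ρ) ≤ 2^l Tr (Q σ)` for every
test `Q`.

The other bound needs a state near `ρ`. Let `v > 0` be the infimum of `Tr (Q σ)` over tests and `ε <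
1`. Lagrange duality (`exists_multiplier`) gives `μ` with `v ≤ Tr (Q σ) + μ (ε - Tr (Q ρ))` whenever
`0 ≤ Q ≤ 1`. For `Q` the projector onto the positive part `X` of `μ ρ - σ` this reads `Tr X ≤ ε μ -
v`. Thus `μ ρ ≤ T` for `T = σ + X`, which exceeds `σ` by little trace. With `G = √σ T^(-1/2)`, after
making `T` invertible, `ρ' = G ρ G†` satisfies `μ ρ' ≤ σ` and has fidelity at least `1 - ε` with `ρ`
(`exists_compression`). As `v / ε ≤ μ`, this `ρ'` witnesses the bound. The conditional version takes
`1 ⊗ ρ_B` for `σ`. -/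

namespace QuantumEntropy

/-! ### Trace inequalities, fidelity and compression. -/

section Trace

variable {n : Type*} [Fintype n]

lemma re_trace_nonneg {A : Matrix n n ℂ} (hA : A.PosSemidef) : 0 ≤ A.trace.re :=
  (Complex.le_def.mp hA.trace_nonneg).1

lemma re_trace_conjTranspose (A : Matrix n n ℂ) : A.conjTranspose.trace.re = A.trace.re := by
  simp [Matrix.trace_conjTranspose]

lemma re_trace_mono {A B : Matrix n n ℂ} (h : A ≤ B) : A.trace.re ≤ B.trace.re := by
  have := re_trace_nonneg (Matrix.le_iff.mp h)
  simpa [Matrix.trace_sub] using this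

variable [DecidableEq n]

lemma posSemidef_sqrt (A : Matrix n n ℂ) : (CFC.sqrt A).PosSemidef :=
  Matrix.nonneg_iff_posSemidef.mp (CFC.sqrt_nonneg A)

lemma sqrt_mul_sqrt {A : Matrix n n ℂ} (hA : A.PosSemidef) : CFC.sqrt A * CFC.sqrt A = A :=
  CFC.sqrt_mul_sqrt_self A (Matrix.nonneg_iff_posSemidef.mpr hA)

lemma re_trace_mul_nonneg {A B : Matrix n n ℂ} (hA : A.PosSemidef) (hB : B.PosSemidef) :
    0 ≤ (A * B).trace.re := by
  have h := hA.mul_mul_conjTranspose_same (CFC.sqrt B)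
  rw [(posSemidef_sqrt B).isHermitian.eq] at h
  have h' := re_trace_nonneg h
  rwa [Matrix.trace_mul_comm, ← mul_assoc, sqrt_mul_sqrt hB, Matrix.trace_mul_comm] at h'

lemma re_trace_mul_mono_right {A B C : Matrix n n ℂ} (hA : A.PosSemidef) (h : B ≤ C) :
    (A * B).trace.re ≤ (A * C).trace.re := by
  have := re_trace_mul_nonneg hA (Matrix.le_iff.mp h)
  simpa [mul_sub, Matrix.trace_sub] using this

lemma re_trace_mul_mono_left {A B C : Matrix n n ℂ} (hA : A.PosSemidef) (h : B ≤ C) :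
    (B * A).trace.re ≤ (C * A).trace.re := by
  rw [Matrix.trace_mul_comm B, Matrix.trace_mul_comm C]
  exact re_trace_mul_mono_right hA h

open scoped Matrix.Norms.L2Operator in
lemma sqrt_mono {A B : Matrix n n ℂ} (h : A ≤ B) : CFC.sqrt A ≤ CFC.sqrt B :=
  CFC.sqrt_le_sqrt A B h

/-- If `P` is positive definite and `Z Z† ≤ P²`, then `Re Tr Z ≤ Tr P`. -/
lemma re_trace_le_of_mul_conjTranspose_le_sq {Z P : Matrix n n ℂ} (hP : P.PosDef)
    (h : Z * Z.conjTranspose ≤ P * P) : Z.trace.re ≤ P.trace.re := by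
  have hdet : IsUnit P.det := (Matrix.isUnit_iff_isUnit_det P).mp hP.isUnit
  -- Expanding this square gives `2 Re Tr Z ≤ Tr P + Re Tr (Z† P⁻¹ Z)`; by `h` the last term is at
  -- most `Tr P`.
  have h1 := re_trace_nonneg (hP.inv.posSemidef.conjTranspose_mul_mul_same (P - Z))
  have h2 := re_trace_mul_mono_right hP.inv.posSemidef h
  have e1 : (P - Z).conjTranspose * P⁻¹ * (P - Z)
      = P - Z - Z.conjTranspose + Z.conjTranspose * P⁻¹ * Z := by
    rw [Matrix.conjTranspose_sub, hP.isHermitian.eq]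
    simp only [sub_mul, mul_sub, Matrix.mul_nonsing_inv P hdet, one_mul, mul_assoc,
      Matrix.nonsing_inv_mul P hdet, mul_one]
    abel
  rw [e1] at h1
  rw [Matrix.nonsing_inv_mul_cancel_left (A := P) P hdet, ← mul_assoc, Matrix.trace_mul_comm,
    ← mul_assoc] at h2
  have h3 := re_trace_conjTranspose Z
  simp only [Matrix.trace_add, Matrix.trace_sub, Complex.add_re, Complex.sub_re] at h1
  linarith

/-- The previous bound applies to `P = √(Z Z†) + t`, which is invertible for `t > 0`; then `t → 0`.
-/
lemma re_trace_le_re_trace_sqrt (Z : Matrix n n ℂ) :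
    Z.trace.re ≤ (CFC.sqrt (Z * Z.conjTranspose)).trace.re := by
  set H := CFC.sqrt (Z * Z.conjTranspose) with hH
  have hpos : H.PosSemidef := posSemidef_sqrt _
  have key : ∀ t : ℝ, 0 < t → Z.trace.re ≤ H.trace.re + t * Fintype.card n := by
    intro t ht
    have ht1 : (t • (1 : Matrix n n ℂ)).PosDef := Matrix.PosDef.one.smul ht
    have h := re_trace_le_of_mul_conjTranspose_le_sq (Z := Z) (P := H + t • 1)
      (ht1.posSemidef_add hpos) ?_
    · simpa [Matrix.trace_add, Matrix.trace_smul] using h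
    · rw [← sqrt_mul_sqrt (Matrix.posSemidef_self_mul_conjTranspose Z), ← hH, Matrix.le_iff]
      have e : (H + t • (1 : Matrix n n ℂ)) * (H + t • 1) - H * H
          = (2 * t) • H + (t * t) • (1 : Matrix n n ℂ) := by
        simp only [add_mul, mul_add, smul_mul_assoc, mul_smul_comm, one_mul, mul_one, smul_add,
          two_mul, add_smul, mul_smul]
        abel
      rw [e]
      exact (hpos.smul (by positivity)).add (Matrix.PosSemidef.one.smul (by positivity))
  refine le_of_forall_pos_le_add fun δ hδ => ?_
  refine (key (δ / (Fintype.card n + 1)) (by positivity)).trans ?_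
  gcongr
  rw [div_mul_eq_mul_div, div_le_iff₀ (by positivity)]
  nlinarith [hδ.le]

/-- The fidelity of `G ρ G†` with `ρ` is at least `Re Tr (G ρ)`. -/
lemma re_trace_mul_le_traceNorm {ρ : Matrix n n ℂ} (hρ : ρ.PosSemidef) (G : Matrix n n ℂ) :
    (G * ρ).trace.re ≤ traceNorm (CFC.sqrt (G * ρ * G.conjTranspose) * CFC.sqrt ρ) := by
  have hr := (posSemidef_sqrt ρ).isHermitian.eq
  have hG := hρ.mul_mul_conjTranspose_same G
  set r := CFC.sqrt ρ
  have hrr : r * r = ρ := sqrt_mul_sqrt hρ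
  set s := CFC.sqrt (G * ρ * G.conjTranspose)
  have hss : s * s = G * ρ * G.conjTranspose := sqrt_mul_sqrt hG
  have hsh : s.conjTranspose = s := (posSemidef_sqrt _).isHermitian.eq
  -- `Z = √ρ G √ρ` has the trace of `G ρ`, and `Z Z†` is `|s r|²`.
  have h := re_trace_le_re_trace_sqrt (r * G * r)
  have e1 : r * G * r * (r * G * r).conjTranspose = (s * r).conjTranspose * (s * r) := by
    simp only [Matrix.conjTranspose_mul, hr, hsh]
    calc r * G * r * (r * (G.conjTranspose * r)) = r * (G * (r * r) * G.conjTranspose) * r := by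
          simp only [mul_assoc]
      _ = r * s * (s * r) := by rw [hrr, ← hss]; simp only [mul_assoc]
  rw [e1, Matrix.trace_mul_comm, ← mul_assoc, hrr, Matrix.trace_mul_comm] at h
  exact h

/-- Compression of a state `ρ ≤ μ⁻¹ T` into `μ⁻¹ σ` for `σ ≤ T`, at a fidelity controlled by
`Tr (T - σ)`. -/
lemma exists_compression {ρ σ T : Matrix n n ℂ} (hρ : IsState ρ) (hσ : σ.PosSemidef)
    (hT : T.PosDef) (hσT : σ ≤ T) {μ ε : ℝ} (hμ : 0 < μ) (hρT : μ • ρ ≤ T)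
    (htr : T.trace.re - σ.trace.re ≤ ε * μ) :
    ∃ ρ' : Matrix n n ℂ, ρ'.PosSemidef ∧ ρ'.trace.re ≤ 1 ∧ μ • ρ' ≤ σ ∧
      1 - ε ≤ traceNorm (CFC.sqrt ρ' * CFC.sqrt ρ) := by
  set R := CFC.sqrt T
  set S := CFC.sqrt σ with hSdef
  have hRps : R.PosSemidef := posSemidef_sqrt T
  have hSps : S.PosSemidef := posSemidef_sqrt σ
  have hRR : R * R = T := sqrt_mul_sqrt hT.posSemidef
  have hSS : S * S = σ := sqrt_mul_sqrt hσ
  have hdet : IsUnit R.det := by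
    have := (Matrix.isUnit_iff_isUnit_det T).mp hT.isUnit
    rw [← hRR, Matrix.det_mul] at this
    exact isUnit_of_mul_isUnit_left this
  have hRi : R⁻¹.conjTranspose = R⁻¹ := hRps.inv.isHermitian.eq
  set G := S * R⁻¹ with hG
  have hGc : G.conjTranspose = R⁻¹ * S := by
    rw [hG, Matrix.conjTranspose_mul, hRi, hSps.isHermitian.eq]
  have hGT : G * T = S * R := by
    rw [hG, ← hRR, mul_assoc, ← mul_assoc R⁻¹, Matrix.nonsing_inv_mul R hdet, one_mul]
  have hGTG : G * T * G.conjTranspose = σ := by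
    rw [hGT, hGc, mul_assoc, ← mul_assoc R, Matrix.mul_nonsing_inv R hdet, one_mul, hSS]
  have hGG : G.conjTranspose * G ≤ 1 := by
    have h := (Matrix.le_iff.mp hσT).mul_mul_conjTranspose_same R⁻¹
    rw [Matrix.le_iff]
    convert h using 1
    rw [hRi, mul_sub, sub_mul, ← hRR, ← hSS, hGc, hG, ← mul_assoc R⁻¹ R,
      Matrix.nonsing_inv_mul R hdet, one_mul, Matrix.mul_nonsing_inv R hdet]
    simp only [mul_assoc]
  have hre : (G * ρ).trace.re = (G.conjTranspose * ρ).trace.re := by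
    rw [← re_trace_conjTranspose (G * ρ), Matrix.conjTranspose_mul, hρ.1.isHermitian.eq,
      Matrix.trace_mul_comm]
  have hreT : (G.conjTranspose * T).trace.re = (G * T).trace.re := by
    rw [← re_trace_conjTranspose (G * T), Matrix.conjTranspose_mul G T, hT.isHermitian.eq,
      Matrix.trace_mul_comm]
  -- The matrix equals `(1 - G)† (1 - G) + (1 - G† G)`.
  have hK : ((2 : Matrix n n ℂ) - G - G.conjTranspose).PosSemidef := by
    have h1 := Matrix.posSemidef_conjTranspose_mul_self (1 - G)
    have h2 := h1.add (Matrix.le_iff.mp hGG)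
    convert h2 using 1
    rw [Matrix.conjTranspose_sub, Matrix.conjTranspose_one, sub_mul, mul_sub, one_mul, one_mul,
      mul_sub, mul_one, ← one_add_one_eq_two]
    abel
  -- Pairing `2 - G - G†` with `μ ρ ≤ T` gives `μ (1 - Re Tr (G ρ)) ≤ Tr T - Re Tr (S R)`, and `S ≤
  -- R` gives `Re Tr (S R) ≥ Tr σ`.
  have hfid : 1 - ε ≤ (G * ρ).trace.re := by
    have h := re_trace_mul_mono_right hK hρT
    have hsq : σ.trace.re ≤ (S * R).trace.re := by
      have := re_trace_mul_mono_right hSps (sqrt_mono hσT)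
      rwa [← hSdef, hSS] at this
    have hρ1 : ρ.trace.re = 1 := by rw [hρ.2]; simp
    simp only [sub_mul, mul_smul_comm, Matrix.trace_sub, Matrix.trace_smul, Complex.sub_re,
      Complex.real_smul, Complex.mul_re, Complex.ofReal_re, Complex.ofReal_im, zero_mul, sub_zero,
      two_mul, Matrix.trace_add, Complex.add_re, smul_add, smul_sub, hreT, ← hre, hρ1, hGT] at h
    have : μ * (1 - ε) ≤ μ * (G * ρ).trace.re := by linarith
    exact le_of_mul_le_mul_left this hμ
  refine ⟨G * ρ * G.conjTranspose, hρ.1.mul_mul_conjTranspose_same G, ?_, ?_,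
    hfid.trans (re_trace_mul_le_traceNorm hρ.1 G)⟩
  · have := re_trace_mul_mono_left hρ.1 hGG
    rwa [one_mul, hρ.2, Complex.one_re, mul_assoc, Matrix.trace_mul_comm] at this
  · have := (Matrix.le_iff.mp hρT).mul_mul_conjTranspose_same G
    rw [mul_sub, sub_mul, hGTG] at this
    rw [Matrix.le_iff]
    simpa using this

/-- The spectral projector of a Hermitian matrix onto its positive part attains the trace of the
positive part. -/
lemma exists_test_posPart {H : Matrix n n ℂ} (hH : H.IsHermitian) :
    ∃ Q X : Matrix n n ℂ, 0 ≤ Q ∧ Q ≤ 1 ∧ 0 ≤ X ∧ H ≤ X ∧ Q * H = X := by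
  have hsa : IsSelfAdjoint H := hH
  have hc : ∀ f : ℝ → ℝ, ContinuousOn f (spectrum ℝ H) := fun f =>
    (Matrix.finite_real_spectrum (A := H)).continuousOn f
  refine ⟨cfc (fun x : ℝ => if 0 < x then 1 else 0) H, cfc (fun x : ℝ => max x 0) H, ?_, ?_, ?_,
    ?_, ?_⟩
  · exact cfc_nonneg fun x _ => by split_ifs <;> simp
  · exact cfc_le_one _ _ fun x _ => by split_ifs <;> simp
  · exact cfc_nonneg fun x _ => le_max_right _ _
  · conv_lhs => rw [← cfc_id' ℝ H]
    exact cfc_mono (fun x _ => le_max_left _ _) (hc _) (hc _)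
  · conv_lhs => rw [← cfc_id' ℝ H]
    -- The previous rewrite also hit the `H` inside the projector; this undoes it there.
    conv_lhs => enter [1]; rw [cfc_id' ℝ H]
    rw [← cfc_mul _ _ H (hc _) (hc _)]
    refine cfc_congr fun x _ => ?_
    simp only [ite_mul, one_mul, zero_mul]
    split_ifs with h
    · exact (max_eq_left h.le).symm
    · exact (max_eq_right (not_lt.mp h)).symm

end Trace

/-! ### The extended base-two logarithm. -/

section Log

lemma log2_mono {x y : ℝ≥0∞} (h : x ≤ y) : log2 x ≤ log2 y :=
  EReal.div_le_div_right_of_nonneg (by exact_mod_cast Real.log_nonneg one_le_two)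
    (ENNReal.log_monotone h)

lemma log2_ofReal {x : ℝ} (hx : 0 < x) : log2 (ENNReal.ofReal x) = (Real.logb 2 x : ℝ) := by
  rw [log2, ENNReal.log_ofReal_of_pos hx, Real.logb, EReal.coe_div]

lemma log2_zero : log2 0 = ⊥ := by
  rw [log2, ENNReal.log_zero]
  exact EReal.bot_div_of_pos_ne_top (by exact_mod_cast Real.log_pos one_lt_two)
    (EReal.coe_ne_top _)

end Log

/-! ### Duality and the two entropy bounds. -/

section Entropy

variable {n : Type*} [Fintype n] [DecidableEq n]

/-- Strong duality for hypothesis testing: a lower bound on `Tr (Q σ)` over all tests of size `ε`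
comes with a Lagrange multiplier. -/
lemma exists_multiplier {ρ σ : Matrix n n ℂ} (hρ : IsState ρ) {ε v : ℝ}
    (hε1 : ε < 1) (hv : ∀ Q ∈ tests ε ρ, v ≤ (Q * σ).trace.re) :
    ∃ μ : ℝ, 0 ≤ μ ∧ ∀ Q : Matrix n n ℂ, 0 ≤ Q → Q ≤ 1 →
      v ≤ (Q * σ).trace.re + μ * (ε - (Q * ρ).trace.re) := by
  let φ (A : Matrix n n ℂ) : Matrix n n ℂ →ₗ[ℝ] ℝ :=
    { toFun := fun Q => (Q * A).trace.re
      map_add' := fun x y => by simp [add_mul, Matrix.trace_add]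
      map_smul' := fun c x => by simp [Matrix.trace_smul] }
  have hK : Convex ℝ (((φ ρ).prod (φ σ)) '' Set.Icc 0 1) := (convex_Icc 0 1).linear_image _
  have hdisj : Disjoint (Set.Ioi ε ×ˢ Set.Iio v) (((φ ρ).prod (φ σ)) '' Set.Icc 0 1) := by
    rw [Set.disjoint_left]
    rintro _ ⟨h1, h2⟩ ⟨Q, ⟨hQ0, hQ1⟩, rfl⟩
    exact (hv Q ⟨hQ0, hQ1, le_of_lt h1⟩).not_gt h2
  -- The attainable pairs `(Tr (Q ρ), Tr (Q σ))` form a convex set that misses the open quadrant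
  -- beating both `ε` and `v`; the slope of a separating line is the multiplier.
  obtain ⟨f, u, hf1, hf2⟩ := geometric_hahn_banach_open
    ((convex_Ioi ε).prod (convex_Iio v)) (isOpen_Ioi.prod isOpen_Iio) hK hdisj
  set α := f (1, 0)
  set β := f (0, 1)
  have hf : ∀ x y : ℝ, f (x, y) = x * α + y * β := fun x y => by
    have : ((x, y) : ℝ × ℝ) = x • (1, 0) + y • (0, 1) := by simp
    rw [this, map_add, map_smul, map_smul, smul_eq_mul, smul_eq_mul]
  have hB : ∀ s t : ℝ, 0 < s → 0 < t → (ε + s) * α + (v - t) * β < u := fun s t hs ht => by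
    rw [← hf]
    exact hf1 _ ⟨by simpa using hs, by simpa using ht⟩
  have hQ : ∀ Q : Matrix n n ℂ, 0 ≤ Q → Q ≤ 1 →
      u ≤ (Q * ρ).trace.re * α + (Q * σ).trace.re * β := fun Q h0 h1 => by
    rw [← hf]
    exact hf2 _ ⟨Q, ⟨h0, h1⟩, rfl⟩
  have hone := hQ 1 zero_le_one le_rfl
  rw [one_mul, hρ.2, Complex.one_re, one_mul] at hone
  have hu : ε * α + v * β ≤ u := by
    refine le_of_forall_pos_le_add fun δ hδ => ?_
    have hd : 0 < δ / (|α| + |β| + 1) := by positivity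
    have h := hB _ _ hd hd
    have h1 : δ / (|α| + |β| + 1) * (|α| + |β| + 1) = δ := by field_simp
    nlinarith [neg_abs_le α, le_abs_self β]
  have hα0 : α ≤ 0 := by
    by_contra! h
    have h1 := hB (1 + |u - ε * α - (v - 1) * β| / α) 1 (by positivity) one_pos
    have h2 : |u - ε * α - (v - 1) * β| / α * α = |u - ε * α - (v - 1) * β| := by field_simp
    nlinarith [le_abs_self (u - ε * α - (v - 1) * β)]
  have hβ0 : 0 ≤ β := by
    by_contra! h
    have h1 := hB 1 (1 + |u - (ε + 1) * α - v * β| / (-β)) one_pos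
      (by have : 0 < -β := by linarith
          positivity)
    have h2 : |u - (ε + 1) * α - v * β| / (-β) * (-β) = |u - (ε + 1) * α - v * β| := by
      have : β ≠ 0 := h.ne
      field_simp
    nlinarith [le_abs_self (u - (ε + 1) * α - v * β)]
  -- Slater's condition: the test `Q = 1` has `Tr (Q ρ) = 1 > ε`, which excludes a vertical
  -- separating line.
  have hβpos : 0 < β := by
    refine lt_of_le_of_ne hβ0 fun h => ?_
    rw [← h] at hone hu
    have h1 := hB 1 1 one_pos one_pos
    rw [← h] at h1
    have hα1 : α = 0 := le_antisymm hα0 (by by_contra! hneg; nlinarith)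
    rw [hα1] at h1 hone
    linarith
  refine ⟨-α / β, div_nonneg (by linarith) hβ0, fun Q h0 h1 => ?_⟩
  have h := hu.trans (hQ Q h0 h1)
  have e : (Q * σ).trace.re + -α / β * (ε - (Q * ρ).trace.re)
      = ((Q * ρ).trace.re * α + (Q * σ).trace.re * β - ε * α) / β := by
    field_simp
    ring
  rw [e, le_div_iff₀ hβpos]
  linarith

lemma exists_substate_of_forall_tests {ρ σ : Matrix n n ℂ} (hρ : IsState ρ) (hσ : σ.PosSemidef)
    {ε v : ℝ} (hε0 : 0 < ε) (hε1 : ε < 1) (hv0 : 0 < v)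
    (hv : ∀ Q ∈ tests ε ρ, v ≤ (Q * σ).trace.re) :
    ∃ ρ' ∈ purifiedBall (Real.sqrt (2 * ε)) ρ, (v / ε) • ρ' ≤ σ := by
  obtain ⟨μ, hμ0, hμ⟩ := exists_multiplier (σ := σ) hρ hε1 hv
  have hH : (μ • ρ - σ).IsHermitian :=
    (hρ.1.smul hμ0).isHermitian.sub hσ.isHermitian
  obtain ⟨Q, X, hQ0, hQ1, hX0, hHX, hQX⟩ := exists_test_posPart hH
  have hX := Matrix.nonneg_iff_posSemidef.mp hX0
  have hXtr : X.trace.re ≤ ε * μ - v := by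
    have h := hμ Q hQ0 hQ1
    rw [← hQX]
    simp only [mul_sub, mul_smul_comm, Matrix.trace_sub, Matrix.trace_smul, Complex.sub_re,
      Complex.real_smul, Complex.mul_re, Complex.ofReal_re, Complex.ofReal_im, zero_mul, sub_zero]
    linarith
  have hvμ : v ≤ ε * μ := by linarith [re_trace_nonneg hX]
  have hμpos : 0 < μ := by
    by_contra! h
    nlinarith
  have hne : Nonempty n := by
    by_contra h
    rw [not_nonempty_iff] at h
    have := hρ.2
    simp [Matrix.trace] at this
  have hcard : (0 : ℝ) < Fintype.card n := by exact_mod_cast Fintype.card_pos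
  -- Adding `η • 1` makes `T` invertible; its trace `v` is exactly the slack in `Tr X ≤ ε μ - v`.
  set η := v / Fintype.card n with hη
  have hηpos : 0 < η := by positivity
  have hη1 : (η • (1 : Matrix n n ℂ)).PosDef := Matrix.PosDef.one.smul hηpos
  obtain ⟨ρ', hρ', htr, hle, hF⟩ := exists_compression (T := X + σ + η • 1) (ε := ε) hρ hσ
    (hη1.posSemidef_add (hX.add hσ))
    (by
      rw [Matrix.le_iff]
      convert hX.add hη1.posSemidef using 1
      abel) hμpos
    (by
      rw [Matrix.le_iff]
      convert (Matrix.le_iff.mp hHX).add hη1.posSemidef using 1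
      abel)
    (by
      have : η * Fintype.card n = v := by rw [hη]; field_simp
      simp only [Matrix.trace_add, Matrix.trace_smul, Matrix.trace_one, Complex.add_re,
        Complex.real_smul, Complex.mul_re, Complex.ofReal_re, Complex.ofReal_im, zero_mul,
        sub_zero, Complex.natCast_re]
      linarith)
  have hpos : 0 < ρ'.trace.re := by
    -- A zero `ρ'` would have fidelity `0`, below `1 - ε > 0`.
    refine lt_of_le_of_ne (re_trace_nonneg hρ') fun h => ?_
    have h0 : ρ' = 0 := by
      rw [← hρ'.trace_eq_zero_iff]
      exact Complex.ext h.symm (Complex.le_def.mp hρ'.trace_nonneg).2.symm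
    rw [h0] at hF
    simp [traceNorm] at hF
    linarith
  refine ⟨ρ', ⟨⟨hρ', hpos, htr⟩, ?_⟩, ?_⟩
  · refine Real.sqrt_le_sqrt ?_
    have : genFidelity ρ' ρ = traceNorm (CFC.sqrt ρ' * CFC.sqrt ρ) := by
      simp [genFidelity, hρ.2]
    rw [this]
    -- `1 - F² ≤ 1 - (1 - ε)² ≤ 2 ε`.
    nlinarith
  · refine le_trans ?_ hle
    rw [Matrix.le_iff, ← sub_smul]
    refine hρ'.smul (sub_nonneg.mpr ?_)
    rw [div_le_iff₀ hε0]
    linarith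

lemma purifiedDist_le_one (ρ σ : Matrix n n ℂ) : purifiedDist ρ σ ≤ 1 := by
  rw [purifiedDist, Real.sqrt_le_one]
  exact sub_le_self 1 (sq_nonneg _)

/-- If the smoothing ball contains all subnormalized states, the smooth relative max-entropy with
respect to a nonzero operator is `-∞`. -/
lemma dMaxSmooth_eq_bot {ρ σ : Matrix n n ℂ} (hσ : σ.PosSemidef) (hσ0 : 0 < σ.trace.re) {δ : ℝ}
    (hδ : 1 ≤ δ) : dMaxSmooth δ ρ σ = ⊥ := by
  rw [EReal.eq_bot_iff_forall_lt]
  intro y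
  have hpow : (0 : ℝ) < 2 ^ (y - 1) := by positivity
  -- The first entry forces `dMax (t • σ) σ ≤ y - 1`, the second keeps the trace at most one.
  set t : ℝ := min (2 ^ (y - 1)) (1 / σ.trace.re)
  have ht0 : 0 < t := by positivity
  have hsub : IsSubstate (t • σ) := by
    have e : (t • σ).trace.re = t * σ.trace.re := by simp [Matrix.trace_smul]
    refine ⟨hσ.smul ht0.le, e ▸ by positivity, e ▸ ?_⟩
    rw [← le_div_iff₀ hσ0]
    exact min_le_right _ _
  have h : dMax (t • σ) σ ≤ ((y - 1 : ℝ) : EReal) := by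
    refine iInf₂_le (y - 1) ?_
    rw [Matrix.le_iff, ← sub_smul]
    exact hσ.smul (sub_nonneg.mpr (min_le_left _ _))
  refine lt_of_le_of_lt ((iInf₂_le (t • σ) ⟨hsub, (purifiedDist_le_one _ _).trans hδ⟩).trans h) ?_
  exact_mod_cast sub_one_lt y

theorem dMaxSmooth_le_dH {ρ σ : Matrix n n ℂ} (hρ : IsState ρ) (hσ : σ.PosSemidef) {ε : ℝ}
    (hε0 : 0 < ε) (hε1 : ε ≤ 1) : dMaxSmooth (Real.sqrt (2 * ε)) ρ σ ≤ dH ε ρ σ := by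
  set w : ℝ≥0∞ := ⨅ Q ∈ tests ε ρ, ENNReal.ofReal (Q * σ).trace.re with hw
  have hone : (1 : Matrix n n ℂ) ∈ tests ε ρ := ⟨zero_le_one, le_rfl, by simpa [hρ.2] using hε1⟩
  have hwσ : w ≤ ENNReal.ofReal σ.trace.re := by
    simpa using iInf₂_le (f := fun Q _ => ENNReal.ofReal (Q * σ).trace.re) 1 hone
  rcases eq_or_ne w 0 with h0 | h0
  · have : dH ε ρ σ = ⊤ := by rw [dH, ← hw, h0, ENNReal.zero_div, log2_zero, EReal.neg_bot]
    exact this ▸ le_top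
  have hwtop : w ≠ ⊤ := ne_top_of_le_ne_top ENNReal.ofReal_ne_top hwσ
  rcases lt_or_eq_of_le hε1 with hε1 | rfl
  · have hv0 : 0 < w.toReal := ENNReal.toReal_pos h0 hwtop
    obtain ⟨ρ', hρ', hle⟩ := exists_substate_of_forall_tests hρ hσ hε0 hε1 hv0 fun Q hQ => by
      refine ENNReal.toReal_le_of_le_ofReal
        (re_trace_mul_nonneg (Matrix.nonneg_iff_posSemidef.mp hQ.1) hσ) ?_
      exact iInf₂_le (f := fun Q _ => ENNReal.ofReal (Q * σ).trace.re) Q hQ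
    have hq : 0 < w.toReal / ε := by positivity
    have hdH : dH ε ρ σ = ((-Real.logb 2 (w.toReal / ε) : ℝ) : EReal) := by
      rw [dH, ← hw, ← ENNReal.ofReal_toReal hwtop, ← ENNReal.ofReal_div_of_pos hε0,
        log2_ofReal (by simpa using hq), EReal.coe_neg, ENNReal.toReal_ofReal hv0.le]
    rw [hdH]
    refine (iInf₂_le ρ' hρ').trans (iInf₂_le _ ?_)
    rw [Real.rpow_neg zero_le_two, Real.rpow_logb zero_lt_two (by norm_num) hq]
    have h := (Matrix.le_iff.mp hle).smul (inv_nonneg.mpr hq.le)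
    rw [smul_sub, smul_smul, inv_mul_cancel₀ hq.ne', one_smul] at h
    exact Matrix.le_iff.mpr h
  -- At `ε = 1` Slater's condition is lost, but the radius `√2` exceeds every purified distance.
  · have hσ0 : 0 < σ.trace.re := by
      by_contra! h
      exact h0 (le_antisymm (hwσ.trans (ENNReal.ofReal_of_nonpos h).le) zero_le)
    rw [dMaxSmooth_eq_bot hσ hσ0]
    · exact bot_le
    · rw [Real.one_le_sqrt]
      norm_num

theorem dH_le_dMax {ρ σ : Matrix n n ℂ} {ε : ℝ} (hε0 : 0 < ε) : dH ε ρ σ ≤ dMax ρ σ := by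
  refine le_iInf₂ fun l hl => ?_
  rw [dH, EReal.neg_le, ← EReal.coe_neg]
  have hpow : (0 : ℝ) < 2 ^ (-l) := by positivity
  have e : ((-l : ℝ) : EReal) = log2 (ENNReal.ofReal (2 ^ (-l))) := by
    rw [log2_ofReal hpow, Real.logb_rpow zero_lt_two (by norm_num)]
  rw [e]
  refine log2_mono ?_
  rw [ENNReal.le_div_iff_mul_le (Or.inl (by simpa using hε0)) (Or.inl ENNReal.ofReal_ne_top),
    ← ENNReal.ofReal_mul hpow.le]
  refine le_iInf₂ fun Q hQ => ENNReal.ofReal_le_ofReal ?_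
  have h := re_trace_mul_mono_right (Matrix.nonneg_iff_posSemidef.mp hQ.1) hl
  rw [mul_smul_comm, Matrix.trace_smul, Complex.smul_re, smul_eq_mul] at h
  rw [Real.rpow_neg zero_le_two, inv_mul_le_iff₀ (by positivity)]
  exact hQ.2.2.trans h

end Entropy

/-! ### Conditional entropies. -/

section Conditional

variable {a b : Type*} [Fintype a]

lemma marginalB_eq_sum (ρ : Matrix (a × b) (a × b) ℂ) :
    marginalB ρ = ∑ k, ρ.submatrix (fun i => (k, i)) fun i => (k, i) := by
  ext i j
  simp [marginalB, Matrix.sum_apply]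

variable [Fintype b]

lemma IsState.marginalB {ρ : Matrix (a × b) (a × b) ℂ} (hρ : IsState ρ) :
    IsState (marginalB ρ) := by
  refine ⟨?_, ?_⟩
  · rw [marginalB_eq_sum]
    exact Matrix.posSemidef_sum _ fun k _ => hρ.1.submatrix _
  · rw [← hρ.2, Matrix.trace, Matrix.trace, Fintype.sum_prod_type_right]
    simp [QuantumEntropy.marginalB]

lemma IsState.isSubstate {n : Type*} [Fintype n] {ρ : Matrix n n ℂ} (hρ : IsState ρ) :
    IsSubstate ρ :=
  ⟨hρ.1, by simp [hρ.2], by simp [hρ.2]⟩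

/-- `hMin` also optimizes over the operator on `B`, so fixing it as `σ` can only lower the value. -/
lemma neg_dMaxSmooth_le_hMin [DecidableEq a] [DecidableEq b] {δ : ℝ}
    (ρ : Matrix (a × b) (a × b) ℂ) {σ : Matrix b b ℂ} (hσ : IsSubstate σ) :
    -dMaxSmooth δ ρ ((1 : Matrix a a ℂ) ⊗ₖ σ) ≤ hMin δ ρ := by
  rw [EReal.neg_le]
  refine le_iInf₂ fun ρ' hρ' => ?_
  rw [EReal.neg_le]
  exact (le_iSup₂ (f := fun (σ : Matrix b b ℂ) (_ : IsSubstate σ) => hMinRel ρ' σ) σ hσ).trans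
    (le_iSup₂ (f := fun ρ' (_ : ρ' ∈ purifiedBall δ ρ) =>
      ⨆ (σ : Matrix b b ℂ) (_ : IsSubstate σ), hMinRel ρ' σ) ρ' hρ')

end Conditional
end QuantumEntropy

theorem mainTheorem1 {a b : Type*} [Fintype a] [DecidableEq a] [Fintype b] [DecidableEq b]
    (ρ : Matrix (a × b) (a × b) ℂ) (hρ : IsState ρ) (ε : ℝ) (hε0 : 0 < ε) (hε1 : ε ≤ 1) :
    (∀ σ : Matrix (a × b) (a × b) ℂ, σ.PosSemidef →
      dMaxSmooth (Real.sqrt (2 * ε)) ρ σ ≤ dH ε ρ σ ∧ dH ε ρ σ ≤ dMax ρ σ) ∧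
    (hH ε ρ ≤ hMin (Real.sqrt (2 * ε)) ρ ∧ hMinRel ρ (marginalB ρ) ≤ hH ε ρ) := by
  have hB : IsState (marginalB ρ) := hρ.marginalB
  refine ⟨fun σ hσ => ⟨dMaxSmooth_le_dH hρ hσ hε0 hε1, dH_le_dMax hε0⟩, ?_, ?_⟩
  · exact (EReal.neg_le_neg_iff.mpr
      (dMaxSmooth_le_dH hρ (Matrix.PosSemidef.one.kronecker hB.1) hε0 hε1)).trans
      (neg_dMaxSmooth_le_hMin ρ hB.isSubstate)
  · exact EReal.neg_le_neg_iff.mpr (dH_le_dMax hε0)
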